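/- For $k\ge 1$ let $p_k$ denote the $k$-th prime, let $\sigma(n)=\sum_{d\mid n}d$, and let $\gamma$ be Euler's constant. Let $(n_j)_{j\ge 0}$ be a sequence of natural numbers with $n_j\to\infty$ of the form $$n_j=\prod_{k=1}^{m_j}p_k^{\alpha_{j,k}},\qquad m_j\ge 1,\quad \alpha_{j,1}\ge\alpha_{j,2}\ge\dots\ge\alpha_{j,m_j}\ge 1 \text{ integers},$$ and define $\varepsilon_{m_j}(n_j)$ by $n_j=\bigl(\prod_{k=1}^{m_j}p_k\bigr)^{1+\varepsilon_{m_j}(n_j)}$. Suppose that $\lim_{j\to\infty}\varepsilon_{m_j}(n_j)=0$. (1) If there are positive integers $A$ and $K_0$, independent of $j$, such that $\alpha_{j,k}\le A$ for all $j$ and all $k$ with $K_0\le k\le m_j$, then $e^{\gamma}n_j\log\log n_j-\sigma(n_j)\to+\infty$ as $j\to\infty$; in particular, this difference is positive for all sufficiently large $j$. (2) For all sufficiently large $j$ there is an index $k\in\{1,\dots,m_j\}$ with $\alpha_{j,k}\le k$, and the least such index $K_j$ satisfies $\lim_{j\to\infty}K_j/m_j=0$. -/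

import Mathlib

open Filter Topology

/-- The `k`-th prime in ascending order, with indices starting at `1`:
`kthPrime 1 = 2`, `kthPrime 2 = 3`, ... It is only used for `1 ≤ k`. -/
noncomputable def kthPrime (k : ℕ) : ℕ := Nat.nth Nat.Prime (k - 1)

/-- The number `∏_{k=1}^m p_k ^ (α k)`. -/
noncomputable def primePowProd (m : ℕ) (α : ℕ → ℕ) : ℕ :=
  ∏ k ∈ Finset.Icc 1 m, kthPrime k ^ α k

/-- The product `∏_{k=1}^m p_k` of the first `m` primes. -/
noncomputable def firstPrimesProd (m : ℕ) : ℕ :=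
  ∏ k ∈ Finset.Icc 1 m, kthPrime k

/-- `ε_m(n) = log n / log (∏_{k=1}^m p_k) - 1`, i.e. `n = (∏_{k=1}^m p_k) ^ (1 + ε_m(n))`
(see `rpow_one_add_epsilonExp`). -/
noncomputable def epsilonExp (m n : ℕ) : ℝ :=
  Real.log n / Real.log (firstPrimesProd m) - 1

/-- `α 1 ≥ α 2 ≥ ... ≥ α m` are positive integers; the values of `α` outside `{1, ..., m}`
play no role. -/
def IsNonincreasingExponents (m : ℕ) (α : ℕ → ℕ) : Prop :=
  (∀ k ∈ Set.Icc 1 m, 1 ≤ α k) ∧ AntitoneOn α (Set.Icc 1 m)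

/-- `D(n) = e^γ n log log n - σ(n)`. -/
noncomputable def robinDifference (n : ℕ) : ℝ :=
  Real.exp Real.eulerMascheroniConstant * n * Real.log (Real.log n)
    - (ArithmeticFunction.sigma 1 n : ℝ)

theorem kthPrime_prime (k : ℕ) : (kthPrime k).Prime :=
  Nat.prime_nth_prime _

theorem one_lt_firstPrimesProd {m : ℕ} (hm : 1 ≤ m) : 1 < firstPrimesProd m := by
  have h1 : kthPrime 1 ∣ firstPrimesProd m :=
    Finset.dvd_prod_of_mem _ (Finset.mem_Icc.2 ⟨le_rfl, hm⟩)
  have h2 : 0 < firstPrimesProd m := Finset.prod_pos fun k _ => (kthPrime_prime k).pos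
  exact lt_of_lt_of_le (kthPrime_prime 1).one_lt (Nat.le_of_dvd h2 h1)

/-- The defining property of `ε_m(n)`. -/
theorem rpow_one_add_epsilonExp {m n : ℕ} (hm : 1 ≤ m) (hn : 1 ≤ n) :
    (firstPrimesProd m : ℝ) ^ (1 + epsilonExp m n) = n := by
  have hP : (1 : ℝ) < firstPrimesProd m := by exact_mod_cast one_lt_firstPrimesProd hm
  have hlog : Real.log (firstPrimesProd m) ≠ 0 := (Real.log_pos hP).ne'
  have hn0 : (0 : ℝ) < n := by exact_mod_cast hn
  rw [Real.rpow_def_of_pos (by linarith), epsilonExp, add_sub_cancel,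
    mul_div_cancel₀ _ hlog, Real.exp_log hn0]

/-!
Both parts are driven by the fact that `ε → 0` forces the number `m` of primes to tend to infinity
(`tendsto_length`): for bounded `m` the numbers `(∏ p_k) ^ (1 + ε)` are bounded.

**The difference.** Multiplicativity gives
`σ(n) / n = ∏ (1 - 1 / p_k)⁻¹ * ∏ (1 - p_k ^ (-α_k - 1))`. The bound `α_{K₀} ≤ A` keeps one factor
of the second product, hence the whole product, below the constant `1 - p_{K₀} ^ (-A - 1) < 1`
(`sigma_primePowProd_le`). By Mertens' third theorem the first product is at most
`(1 + o(1)) e^γ log p_m`, whereas Chebyshev's bound `θ(x) ≥ x / 2` gives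
`log log n ≥ log θ(p_m) ≥ log p_m - O(1)`. The constant gained therefore beats all error terms, and
`e^γ log log n - σ(n) / n` is at least a positive multiple of `log p_m`, up to `O(1)`.

**The index.** If `α_k > k` for all `k ≤ L`, then `log n` exceeds `log ∏ p_k` by at least
`∑_{k ≤ L} k log 2`. As `p_k ≤ 2 ^ k` by Bertrand's postulate, `log ∏ p_k ≤ m² log 2`, so that
`L² ≤ 2 ε m²` (`sq_le_of_forall_lt`). With `ε → 0` this excludes `L ≥ c m`.

**Mertens' third theorem with its constant.** Only the upper bound is needed. Legendre's formula for
`log N!` shows that `∑_{p < N} log p / p = log N + O(1)`, and summation by parts turns this into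
`∑_{p < N} 1 / p = log log N + B + o(1)`. To compare `B` with `γ`, let `b_i` be the sum of `1 / p`
over `2 ^ i ≤ p < 2 ^ (i + 1)`. Since `∑_{i < M} b_i` and the harmonic sum `∑_{0 < i < M} 1 / i` are
both `log M` plus a constant up to `o(1)`, Abel's limit theorem gives
`∑ b_i r ^ i = -log (1 - r) + B + log log 2 - γ + o(1)` as `r → 1⁻`. For `r = 2 ^ (-δ)` one has
`r ^ (i + 1) ≤ p ^ (-δ)` on the `i`-th block, so the Euler product bounds `r * ∑ b_i r ^ i` by
`log ζ(1 + δ)` minus the contribution of higher prime powers, and `δ ζ(1 + δ) → 1` yields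
`B + ∑_p (-log (1 - 1 / p) - 1 / p) ≤ γ` (`add_sum_neg_log_one_sub_sub_le`).
-/

/-! ### Legendre's formula and Mertens' first theorem -/

theorem log_factorial_eq_sum (n : ℕ) :
    Real.log n.factorial =
      ∑ p ∈ n.primesLE, (n.factorial.factorization p : ℝ) * Real.log p := by
  have h := Nat.prod_factorization_pow_eq_self n.factorial_ne_zero
  conv_lhs => rw [← h]
  rw [Finsupp.prod, Nat.cast_prod, Real.log_prod]
  · have hs : n.factorial.factorization.support ⊆ n.primesLE := by
      intro p hp
      rw [Nat.support_factorization, Nat.mem_primeFactors] at hp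
      rw [Nat.mem_primesLE]
      exact ⟨(hp.1.dvd_factorial).1 hp.2.1, hp.1⟩
    rw [Finset.sum_subset hs]
    · refine Finset.sum_congr rfl fun p _ => ?_
      rw [Nat.cast_pow, Real.log_pow]
    · intro p _ hp
      rw [Finsupp.notMem_support_iff.1 hp]
      simp
  · intro p hp
    rw [Nat.support_factorization, Nat.mem_primeFactors] at hp
    have := hp.1.pos
    positivity

theorem mul_log_sub_le_log_factorial (n : ℕ) :
    n * Real.log n - n ≤ Real.log n.factorial := by
  rcases n.eq_zero_or_pos with rfl | hn
  · simp
  have h := Real.pow_div_factorial_le_exp (n : ℝ) (by positivity) n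
  have hn' : (0 : ℝ) < n := by exact_mod_cast hn
  have hf : (0 : ℝ) < n.factorial := by exact_mod_cast n.factorial_pos
  have := Real.log_le_log (by positivity) h
  rw [Real.log_exp, Real.log_div (by positivity) (by positivity), Real.log_pow] at this
  linarith

theorem log_factorial_le (n : ℕ) : Real.log n.factorial ≤ n * Real.log n := by
  rw [← Real.log_pow]
  exact Real.log_le_log (by exact_mod_cast n.factorial_pos) (by exact_mod_cast n.factorial_le_pow)

theorem div_le_factorization_factorial {p : ℕ} (hp : p.Prime) (n : ℕ) :
    n / p ≤ n.factorial.factorization p := by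
  rw [← hp.pow_dvd_iff_le_factorization n.factorial_ne_zero,
    hp.pow_dvd_factorial_iff (Nat.lt_succ_self _)]
  rcases lt_or_ge n p with h | h
  · simp [Nat.div_eq_of_lt h]
  · have h1 : (1 : ℕ) ∈ Finset.Ico 1 (Nat.log p n).succ := by
      rw [Finset.mem_Ico]
      exact ⟨le_rfl, Nat.lt_succ_of_le ((Nat.le_log_iff_pow_le hp.one_lt (by have := hp.pos; lia)).2 (by simpa using h))⟩
    simpa using Finset.single_le_sum (f := fun i => n / p ^ i) (fun _ _ => Nat.zero_le _) h1

theorem factorization_factorial_le {p : ℕ} (hp : p.Prime) (n : ℕ) :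
    (n.factorial.factorization p : ℝ) ≤ n / (p - 1) := by
  have := Fact.mk hp
  have h := sub_one_mul_padicValNat_factorial (p := p) n
  have h1 : (p - 1) * n.factorial.factorization p ≤ n := by
    rw [Nat.factorization_def _ hp, h]; exact Nat.sub_le _ _
  have h2 : (1 : ℝ) < p := by exact_mod_cast hp.one_lt
  rw [le_div_iff₀ (by linarith), mul_comm]
  have h3 : (((p - 1 : ℕ) : ℝ)) * n.factorial.factorization p ≤ n := by exact_mod_cast h1
  rwa [Nat.cast_sub hp.one_lt.le, Nat.cast_one] at h3

theorem summable_log_div_mul_sub_one :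
    Summable fun n : ℕ => Real.log n / (n * (n - 1) : ℝ) := by
  have h : Summable fun n : ℕ => 4 * (1 / (n : ℝ) ^ (3 / 2 : ℝ)) :=
    (Real.summable_one_div_nat_rpow.2 (by norm_num)).mul_left 4
  refine Summable.of_norm_bounded h fun n => ?_
  rcases lt_or_ge n 2 with h | h
  · interval_cases n <;> simp [Real.zero_rpow]
  have hn : (2 : ℝ) ≤ n := by exact_mod_cast h
  have h0 : (0 : ℝ) < n := by linarith
  have hl : Real.log n ≤ 2 * (n : ℝ) ^ (1 / 2 : ℝ) := by
    have := Real.log_le_rpow_div h0.le (ε := 1 / 2) (by norm_num)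
    linarith
  rw [Real.norm_of_nonneg (div_nonneg (Real.log_nonneg (by linarith))
    (mul_nonneg h0.le (by linarith)))]
  have e : (n : ℝ) ^ (1 / 2 : ℝ) * (n : ℝ) ^ (3 / 2 : ℝ) = n ^ 2 := by
    rw [← Real.rpow_add h0]; norm_num
  have h3 : (0 : ℝ) < (n : ℝ) ^ (3 / 2 : ℝ) := by positivity
  rw [div_le_iff₀ (by nlinarith), mul_one_div, div_mul_eq_mul_div, le_div_iff₀ h3]
  calc Real.log n * (n : ℝ) ^ (3 / 2 : ℝ)
      ≤ 2 * (n : ℝ) ^ (1 / 2 : ℝ) * (n : ℝ) ^ (3 / 2 : ℝ) := by gcongr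
    _ = 2 * n ^ 2 := by rw [mul_assoc, e]
    _ ≤ 4 * (n * (n - 1)) := by nlinarith

/-- **Mertens' first theorem.** Both bounds compare `n log n - n ≤ log n! ≤ n log n` with
`log n! = ∑ v_p(n!) log p`, where `n / p - 1 ≤ v_p(n!) ≤ n / (p - 1)`. -/
theorem exists_abs_sum_log_div_sub_log_le :
    ∃ C : ℝ, ∀ n : ℕ, 2 ≤ n → |∑ p ∈ n.primesBelow, Real.log p / p - Real.log n| ≤ C := by
  set D := ∑' n : ℕ, Real.log n / (n * (n - 1) : ℝ)
  have main : ∀ n : ℕ, 1 ≤ n →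
      (∑ p ∈ n.primesLE, Real.log p / p ≤ Real.log n + Real.log 4) ∧
      (Real.log n - 1 - D ≤ ∑ p ∈ n.primesLE, Real.log p / p) := by
    intro n hn
    have hn0 : (0 : ℝ) < n := by exact_mod_cast hn
    have hL := log_factorial_eq_sum n
    constructor
    · have h1 : ∑ p ∈ n.primesLE, (n / p - 1 : ℝ) * Real.log p ≤ n * Real.log n := by
        refine le_trans ?_ (hL ▸ log_factorial_le n)
        refine Finset.sum_le_sum fun p hp => ?_
        have hpp := (Nat.mem_primesLE.1 hp).2
        have h2 : (n / p : ℝ) - 1 ≤ (n.factorial.factorization p : ℝ) := by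
          have h3 : ((n / p : ℕ) : ℝ) ≤ _ := Nat.cast_le.2 (div_le_factorization_factorial hpp n)
          have h4 := Nat.lt_floor_add_one ((n : ℝ) / p)
          rw [Nat.floor_div_eq_div] at h4
          linarith
        exact mul_le_mul_of_nonneg_right h2 (Real.log_nonneg (by exact_mod_cast hpp.one_le))
      have h2 := Chebyshev.theta_le_log4_mul_x hn0.le
      rw [Chebyshev.theta_eq_sum_primesLE_log] at h2
      have h3 : ∑ p ∈ n.primesLE, (n / p - 1 : ℝ) * Real.log p =
          n * (∑ p ∈ n.primesLE, Real.log p / p) - ∑ p ∈ n.primesLE, Real.log p := by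
        rw [Finset.mul_sum, ← Finset.sum_sub_distrib]
        exact Finset.sum_congr rfl fun p _ => by ring
      refine le_of_mul_le_mul_left ?_ hn0
      linarith
    · have h1 : Real.log n.factorial ≤
          ∑ p ∈ n.primesLE, (n * (Real.log p / p) + n * (Real.log p / (p * (p - 1)))) := by
        rw [hL]
        refine Finset.sum_le_sum fun p hp => ?_
        have hpp := (Nat.mem_primesLE.1 hp).2
        have hp1 : (1 : ℝ) < p := by exact_mod_cast hpp.one_lt
        have h2 := mul_le_mul_of_nonneg_right (factorization_factorial_le hpp n)
          (Real.log_nonneg hp1.le)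
        refine h2.trans (le_of_eq ?_)
        have : (p : ℝ) - 1 ≠ 0 := by linarith
        have : (p : ℝ) ≠ 0 := by linarith
        field_simp
        ring
      rw [Finset.sum_add_distrib, ← Finset.mul_sum, ← Finset.mul_sum] at h1
      have h2 : ∑ p ∈ n.primesLE, Real.log p / (p * (p - 1) : ℝ) ≤ D := by
        refine summable_log_div_mul_sub_one.sum_le_tsum _ fun i _ => ?_
        rcases i.eq_zero_or_pos with rfl | hi
        · simp
        have : (1 : ℝ) ≤ i := by exact_mod_cast hi
        exact div_nonneg (Real.log_nonneg this) (mul_nonneg (by linarith) (by linarith))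
      have h3 := mul_log_sub_le_log_factorial n
      refine le_of_mul_le_mul_left ?_ hn0
      have := mul_le_mul_of_nonneg_left h2 hn0.le
      linarith
  refine ⟨max (Real.log 4) (1 + D + Real.log 2), fun n hn => ?_⟩
  obtain ⟨k, rfl⟩ : ∃ k, n = k + 1 := ⟨n - 1, by lia⟩
  have hk : (1 : ℝ) ≤ k := by exact_mod_cast (by lia : 1 ≤ k)
  obtain ⟨h1, h2⟩ := main k (by lia)
  rw [Nat.primesLE] at h1 h2
  have h3 : Real.log k ≤ Real.log (k + 1 : ℕ) :=
    Real.log_le_log (by linarith) (by push_cast; linarith)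
  have h4 : Real.log (k + 1 : ℕ) ≤ Real.log k + Real.log 2 := by
    rw [← Real.log_mul (by linarith) (by norm_num)]
    exact Real.log_le_log (by positivity) (by push_cast; linarith)
  rw [abs_le]
  constructor
  · have := le_max_right (Real.log 4) (1 + D + Real.log 2); linarith
  · have := le_max_left (Real.log 4) (1 + D + Real.log 2); linarith

/-! ### Mertens' second theorem -/

theorem primesBelow_sum_succ (f : ℕ → ℝ) (n : ℕ) :
    ∑ p ∈ (n + 1).primesBelow, f p =
      ∑ p ∈ n.primesBelow, f p + if n.Prime then f n else 0 := by
  simp only [Nat.primesBelow, Finset.sum_filter, Finset.sum_range_succ]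

/-- **Mertens' second theorem**, without an error term: after subtraction of the boundary term
`(∑_{p < n} log p / p - log n) / log n`, which tends to `0`, the increments of the sequence are
absolutely summable. -/
theorem exists_tendsto_sum_one_div_sub_log_log :
    ∃ B : ℝ, Tendsto (fun n : ℕ => ∑ p ∈ n.primesBelow, 1 / (p : ℝ) - Real.log (Real.log n))
      atTop (𝓝 B) := by
  obtain ⟨C, hC⟩ := exists_abs_sum_log_div_sub_log_le
  -- shift by `2`, so that `l n = log (n + 2)` is positive
  set l : ℕ → ℝ := fun n => Real.log (n + 2 : ℕ) with hl
  set R : ℕ → ℝ := fun n => ∑ p ∈ (n + 2).primesBelow, Real.log p / p - l n with hR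
  set z : ℕ → ℝ := fun n => l (n + 1) / l n - 1 with hz
  set v : ℕ → ℝ := fun n =>
    ∑ p ∈ (n + 2).primesBelow, 1 / (p : ℝ) - Real.log (l n) - R n / l n with hv
  have hl_pos : ∀ n, 0 < l n := fun n => Real.log_pos (by norm_cast; lia)
  have hl2 : ∀ n, Real.log 2 ≤ l n := fun n =>
    Real.log_le_log (by norm_num) (by push_cast; linarith [(Nat.cast_nonneg n : (0 : ℝ) ≤ n)])
  have hmono : ∀ n, l n ≤ l (n + 1) := fun n =>
    Real.log_le_log (by positivity) (by norm_cast; lia)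
  have hl_top : Tendsto l atTop atTop :=
    Real.tendsto_log_atTop.comp (tendsto_natCast_atTop_atTop.comp (tendsto_add_atTop_nat 2))
  have hRC : ∀ n, |R n| ≤ C := fun n => hC (n + 2) (by lia)
  have hz0 : ∀ n, 0 ≤ z n := fun n => by
    have := (one_le_div (hl_pos n)).2 (hmono n)
    simp only [hz]; linarith
  have hz1 : ∀ n, z n ≤ (1 / Real.log 2) * (1 / ((n : ℝ) + 1)) := fun n => by
    have h1 : l (n + 1) - l n ≤ 1 / ((n : ℝ) + 1) := by
      simp only [hl]
      rw [← Real.log_div (by positivity) (by positivity)]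
      refine (Real.log_le_sub_one_of_pos (by positivity)).trans ?_
      push_cast
      rw [div_sub_one (by positivity)]
      have : (0 : ℝ) ≤ n := Nat.cast_nonneg n
      rw [div_le_div_iff₀ (by positivity) (by positivity)]
      nlinarith
    have h2 : z n = (l (n + 1) - l n) / l n := by
      simp only [hz]; rw [sub_div, div_self (hl_pos n).ne']
    rw [h2, ← one_div_mul_eq_div, mul_comm]
    have hlog2 : 0 < Real.log 2 := Real.log_pos (by norm_num)
    rw [mul_comm]
    exact mul_le_mul (one_div_le_one_div_of_le hlog2 (hl2 n)) h1
      (sub_nonneg.2 (hmono n)) (by positivity)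
  -- `1 / p = (log p / p) / log p`, and `log (l (n + 1)) - log (l n) = log (1 + z n)`
  have hstep : ∀ n, v (n + 1) - v n =
      R (n + 1) * (1 / l n - 1 / l (n + 1)) + (z n - Real.log (1 + z n)) := fun n => by
    have hA : (if (n + 2).Prime then 1 / ((n + 2 : ℕ) : ℝ) else 0) =
        (R (n + 1) + l (n + 1) - R n - l n) / l n := by
      have : R (n + 1) + l (n + 1) - R n - l n =
          if (n + 2).Prime then Real.log (n + 2 : ℕ) / ((n + 2 : ℕ) : ℝ) else 0 := by
        simp only [hR]
        rw [primesBelow_sum_succ (fun p => Real.log p / p) (n + 2)]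
        ring
      rw [this]
      split_ifs
      · have := (hl_pos n).ne'
        simp only [hl] at this ⊢
        rw [div_right_comm, div_self this]
      · simp
    have hlog : Real.log (1 + z n) = Real.log (l (n + 1)) - Real.log (l n) := by
      rw [← Real.log_div (hl_pos _).ne' (hl_pos _).ne']
      simp [hz]
    simp only [hv]
    rw [primesBelow_sum_succ (fun p => 1 / (p : ℝ)) (n + 2), hA, hlog]
    simp only [hz]
    have := (hl_pos n).ne'
    have := (hl_pos (n + 1)).ne'
    field_simp
    ring
  have hsum1 : Summable fun n => 1 / l n - 1 / l (n + 1) := by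
    refine summable_of_sum_range_le (c := 1 / l 0)
      (fun n => sub_nonneg.2 (one_div_le_one_div_of_le (hl_pos n) (hmono n))) fun n => ?_
    rw [Finset.sum_range_sub']
    have : 0 < 1 / l n := one_div_pos.2 (hl_pos n)
    linarith
  have hsum2 : Summable fun n : ℕ => ((1 / Real.log 2) * (1 / ((n : ℝ) + 1))) ^ 2 := by
    have h := (summable_nat_add_iff 1).2 (Real.summable_one_div_nat_pow.2 (by norm_num : 1 < 2))
    refine (h.mul_left ((1 / Real.log 2) ^ 2)).congr fun n => ?_
    rw [mul_pow, div_pow 1 ((n : ℝ) + 1), one_pow]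
    push_cast
    rfl
  have hsum : Summable fun n => v (n + 1) - v n := by
    refine Summable.of_norm_bounded ((hsum1.mul_left C).add hsum2) fun n => ?_
    rw [hstep, Real.norm_eq_abs]
    refine (abs_add_le _ _).trans (add_le_add ?_ ?_)
    · rw [abs_mul, abs_of_nonneg
        (sub_nonneg.2 (one_div_le_one_div_of_le (hl_pos n) (hmono n)))]
      exact mul_le_mul_of_nonneg_right (hRC _)
        (sub_nonneg.2 (one_div_le_one_div_of_le (hl_pos n) (hmono n)))
    · have h0 := hz0 n
      have h1 := Real.log_le_sub_one_of_pos (by linarith : 0 < 1 + z n)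
      have h2 := Real.one_sub_inv_le_log_of_pos (by linarith : 0 < 1 + z n)
      rw [abs_of_nonneg (by linarith)]
      have h3 : z n - z n ^ 2 ≤ 1 - (1 + z n)⁻¹ := by
        have : 1 - (1 + z n)⁻¹ - (z n - z n ^ 2) = z n ^ 3 / (1 + z n) := by
          field_simp
          ring
        have : 0 ≤ z n ^ 3 / (1 + z n) := by positivity
        linarith
      have h4 : z n ^ 2 ≤ ((1 / Real.log 2) * (1 / ((n : ℝ) + 1))) ^ 2 :=
        pow_le_pow_left₀ h0 (hz1 n) 2
      linarith
  obtain ⟨S, hS⟩ := hsum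
  have hv_lim : Tendsto v atTop (𝓝 (S + v 0)) := by
    refine (hS.tendsto_sum_nat.add_const (v 0)).congr fun n => ?_
    rw [Finset.sum_range_sub]; ring
  have hw : Tendsto (fun n => R n / l n) atTop (𝓝 0) := by
    refine squeeze_zero_norm (a := fun n => C / l n) (fun n => ?_) (hl_top.const_div_atTop C)
    rw [norm_div, Real.norm_eq_abs, Real.norm_of_nonneg (hl_pos n).le]
    exact div_le_div_of_nonneg_right (hRC n) (hl_pos n).le
  refine ⟨S + v 0 + 0, (tendsto_add_atTop_iff_nat 2).1 ((hv_lim.add hw).congr fun n => ?_)⟩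
  simp only [hv]
  ring

/-! ### Euler product bound and sums over dyadic blocks of primes -/

/-- A finite part of the Euler product of `ζ(s)` is at most `ζ(s)`, in logarithmic form. -/
theorem sum_neg_log_one_sub_rpow_le {s : ℝ} (hs : 1 < s) (N : ℕ) :
    ∑ p ∈ N.primesBelow, -Real.log (1 - (p : ℝ) ^ (-s)) ≤
      Real.log (∑' n : ℕ, 1 / (n : ℝ) ^ s) := by
  let f : ℕ →* ℝ :=
    { toFun := fun n => (n : ℝ) ^ (-s)
      map_one' := by simp
      map_mul' := fun a b => by
        rw [Nat.cast_mul, Real.mul_rpow (Nat.cast_nonneg _) (Nat.cast_nonneg _)] }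
  have hf : ∀ n, f n = 1 / (n : ℝ) ^ s := fun n => by
    change (n : ℝ) ^ (-s) = _
    rw [Real.rpow_neg (Nat.cast_nonneg _), one_div]
  have hsum : Summable f := by
    simpa only [← hf] using Real.summable_one_div_nat_rpow.2 hs
  have h0 : ∀ n, 0 ≤ f n := fun n => Real.rpow_nonneg (Nat.cast_nonneg n) _
  have h1 : ∀ p ∈ N.primesBelow, 0 < 1 - f p := fun p hp => by
    change 0 < 1 - (p : ℝ) ^ (-s)
    have := (Nat.prime_of_mem_primesBelow hp).one_lt
    linarith [Real.rpow_lt_one_of_one_lt_of_neg (x := (p : ℝ)) (z := -s)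
      (by exact_mod_cast this) (by linarith)]
  have key := EulerProduct.prod_primesBelow_geometric_eq_tsum_smoothNumbers hsum N
  have hle : ∑' m : N.smoothNumbers, f m ≤ ∑' n, f n :=
    Summable.tsum_subtype_le f N.smoothNumbers h0 hsum
  rw [← key] at hle
  have hpos : 0 < ∏ p ∈ N.primesBelow, (1 - f p)⁻¹ :=
    Finset.prod_pos fun p hp => inv_pos.2 (h1 p hp)
  have := Real.log_le_log hpos hle
  rw [Real.log_prod fun p hp => (inv_pos.2 (h1 p hp)).ne'] at this
  simp only [← hf]
  refine le_trans (le_of_eq ?_) this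
  exact Finset.sum_congr rfl fun p _ => by rw [Real.log_inv]; rfl

/-- The sum of the reciprocals of the primes in the dyadic block `[2 ^ i, 2 ^ (i + 1))`. -/
noncomputable def dyadicPrimeSum (i : ℕ) : ℝ :=
  ∑ p ∈ (Finset.Ico (2 ^ i) (2 ^ (i + 1))).filter Nat.Prime, 1 / (p : ℝ)

theorem primesBelow_two_pow_succ_sum (f : ℕ → ℝ) (M : ℕ) :
    ∑ p ∈ Nat.primesBelow (2 ^ (M + 1)), f p = ∑ p ∈ Nat.primesBelow (2 ^ M), f p +
      ∑ p ∈ (Finset.Ico (2 ^ M) (2 ^ (M + 1))).filter Nat.Prime, f p := by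
  simp only [Nat.primesBelow, Finset.sum_filter]
  exact (Finset.sum_range_add_sum_Ico _ (Nat.pow_le_pow_right (by norm_num) M.le_succ)).symm

theorem sum_dyadicPrimeSum (M : ℕ) :
    ∑ i ∈ Finset.range M, dyadicPrimeSum i = ∑ p ∈ Nat.primesBelow (2 ^ M), 1 / (p : ℝ) := by
  induction M with
  | zero => simp [Nat.primesBelow, Finset.filter_singleton, Nat.not_prime_zero]
  | succ M ih => rw [Finset.sum_range_succ, ih, primesBelow_two_pow_succ_sum]; rfl

theorem dyadicPrimeSum_nonneg (i : ℕ) : 0 ≤ dyadicPrimeSum i :=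
  Finset.sum_nonneg fun _ _ => by positivity

theorem dyadicPrimeSum_le_one (i : ℕ) : dyadicPrimeSum i ≤ 1 := by
  calc dyadicPrimeSum i
      ≤ ∑ p ∈ (Finset.Ico (2 ^ i) (2 ^ (i + 1))).filter Nat.Prime, 1 / (2 : ℝ) ^ i := by
        refine Finset.sum_le_sum fun p hp => ?_
        have := (Finset.mem_Ico.1 (Finset.mem_filter.1 hp).1).1
        exact one_div_le_one_div_of_le (by positivity) (by exact_mod_cast this)
    _ ≤ ∑ p ∈ Finset.Ico (2 ^ i) (2 ^ (i + 1)), 1 / (2 : ℝ) ^ i :=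
        Finset.sum_le_sum_of_subset_of_nonneg (Finset.filter_subset _ _)
          fun _ _ _ => by positivity
    _ = 1 := by
        rw [Finset.sum_const, Nat.card_Ico, pow_succ, mul_two, Nat.add_sub_cancel, nsmul_eq_mul]
        push_cast
        field_simp

/-- Along powers of `2`, `log log (2 ^ M) = log M + log log 2`, so dyadic block sums of `1 / p` are
comparable with the harmonic series. The term `1 / i` is `0` for `i = 0`. -/
theorem tendsto_sum_dyadicPrimeSum_sub {B : ℝ}
    (hB : Tendsto (fun n : ℕ => ∑ p ∈ n.primesBelow, 1 / (p : ℝ) - Real.log (Real.log n))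
      atTop (𝓝 B)) :
    Tendsto (fun M : ℕ => ∑ i ∈ Finset.range M, (dyadicPrimeSum i - 1 / (i : ℝ))) atTop
      (𝓝 (B + Real.log (Real.log 2) - Real.eulerMascheroniConstant)) := by
  have h1 := hB.comp (tendsto_pow_atTop_atTop_of_one_lt (by norm_num : 1 < 2))
  have h2 := Real.tendsto_harmonic_sub_log
  rw [← tendsto_add_atTop_iff_nat 1]
  have h3 := ((tendsto_add_atTop_iff_nat 1).2 h1).add_const (Real.log (Real.log 2)) |>.sub h2
  have h4 : Tendsto (fun n : ℕ => Real.log ((n + 1 : ℕ) : ℝ) - Real.log n) atTop (𝓝 0) := by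
    simpa using Real.tendsto_log_nat_add_one_sub_log
  have h5 := h3.add h4
  rw [add_zero] at h5
  refine h5.congr' ?_
  filter_upwards [eventually_ge_atTop 1] with n hn
  have hl2 : 0 < Real.log 2 := Real.log_pos (by norm_num)
  rw [Finset.sum_sub_distrib, sum_dyadicPrimeSum]
  have h6 : ∑ i ∈ Finset.range (n + 1), 1 / (i : ℝ) = ((harmonic n : ℚ) : ℝ) := by
    rw [Finset.sum_range_succ', harmonic]
    push_cast
    simp
  rw [h6]
  simp only [Function.comp]
  have h7 : Real.log (Real.log ((2 ^ (n + 1) : ℕ) : ℝ)) =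
      Real.log ((n + 1 : ℕ) : ℝ) + Real.log (Real.log 2) := by
    rw [Nat.cast_pow, Real.log_pow, Real.log_mul (by positivity) (by exact_mod_cast hl2.ne')]
    simp
  rw [h7]
  ring

/-! ### The constant in Mertens' third theorem -/

theorem neg_log_one_sub_sub_nonneg {x : ℝ} (hx : x < 1) : 0 ≤ -Real.log (1 - x) - x := by
  linarith [Real.log_le_sub_one_of_pos (by linarith : 0 < 1 - x)]

theorem natCast_rpow_neg_lt_one {p : ℕ} (hp : p.Prime) {s : ℝ} (hs : 0 < s) :
    (p : ℝ) ^ (-s) < 1 :=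
  Real.rpow_lt_one_of_one_lt_of_neg (by exact_mod_cast hp.one_lt) (by linarith)

theorem sum_dyadicPrimeSum_mul_pow_le {δ : ℝ} (hδ : 0 < δ) (M : ℕ) :
    ∑ i ∈ Finset.range M, dyadicPrimeSum i * ((2 : ℝ) ^ (-δ)) ^ (i + 1) ≤
      ∑ p ∈ Nat.primesBelow (2 ^ M), (p : ℝ) ^ (-(1 + δ)) := by
  induction M with
  | zero => simp [Nat.primesBelow, Finset.filter_singleton, Nat.not_prime_zero]
  | succ M ih =>
    rw [Finset.sum_range_succ, primesBelow_two_pow_succ_sum]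
    refine add_le_add ih ?_
    rw [dyadicPrimeSum, Finset.sum_mul]
    refine Finset.sum_le_sum fun p hp => ?_
    rw [Finset.mem_filter, Finset.mem_Ico] at hp
    have hp0 : (0 : ℝ) < p := by exact_mod_cast hp.2.pos
    rw [neg_add, Real.rpow_add hp0, Real.rpow_neg_one, one_div]
    refine mul_le_mul_of_nonneg_left ?_ (by positivity)
    rw [← Real.rpow_natCast, ← Real.rpow_mul (by norm_num), mul_comm, Real.rpow_mul (by norm_num),
      Real.rpow_natCast]
    exact Real.rpow_le_rpow_of_nonpos hp0 (by exact_mod_cast hp.1.2.le) (by linarith)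

theorem summable_dyadicPrimeSum_mul_pow {r : ℝ} (h0 : 0 ≤ r) (h1 : r < 1) :
    Summable fun i => dyadicPrimeSum i * r ^ i :=
  Summable.of_nonneg_of_le (fun i => mul_nonneg (dyadicPrimeSum_nonneg i) (pow_nonneg h0 i))
    (fun i => mul_le_of_le_one_left (pow_nonneg h0 i) (dyadicPrimeSum_le_one i))
    (summable_geometric_of_lt_one h0 h1)

/-- The prime powers with exponent at least `2` in `log ζ(1 + δ)` may be dropped for `p ≥ P`, since
their contribution `-log (1 - x) - x`, `x = p ^ (-1 - δ)`, is nonnegative. -/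
theorem dyadicPrimeSum_tsum_add_le {δ : ℝ} (hδ : 0 < δ) (P : ℕ) :
    (2 : ℝ) ^ (-δ) * ∑' i, dyadicPrimeSum i * ((2 : ℝ) ^ (-δ)) ^ i +
      ∑ p ∈ P.primesBelow, (-Real.log (1 - (p : ℝ) ^ (-(1 + δ))) - (p : ℝ) ^ (-(1 + δ))) ≤
      Real.log (∑' n : ℕ, 1 / (n : ℝ) ^ (1 + δ)) := by
  have hr0 : (0 : ℝ) ≤ 2 ^ (-δ) := by positivity
  have hr1 : (2 : ℝ) ^ (-δ) < 1 :=
    Real.rpow_lt_one_of_one_lt_of_neg (by norm_num) (by linarith)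
  have hlim := (((summable_dyadicPrimeSum_mul_pow hr0 hr1).hasSum.mul_left
    ((2 : ℝ) ^ (-δ))).tendsto_sum_nat).add_const
      (∑ p ∈ P.primesBelow, (-Real.log (1 - (p : ℝ) ^ (-(1 + δ))) - (p : ℝ) ^ (-(1 + δ))))
  refine le_of_tendsto hlim ?_
  filter_upwards [eventually_ge_atTop P] with M hM
  refine le_trans ?_ (sum_neg_log_one_sub_rpow_le (by linarith : 1 < 1 + δ) (2 ^ M))
  have h1 := sum_dyadicPrimeSum_mul_pow_le hδ M
  have h2 : ∑ p ∈ P.primesBelow,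
        (-Real.log (1 - (p : ℝ) ^ (-(1 + δ))) - (p : ℝ) ^ (-(1 + δ))) ≤
      ∑ p ∈ Nat.primesBelow (2 ^ M),
        (-Real.log (1 - (p : ℝ) ^ (-(1 + δ))) - (p : ℝ) ^ (-(1 + δ))) := by
    refine Finset.sum_le_sum_of_subset_of_nonneg (fun p hp => ?_) fun p hp _ => ?_
    · rw [Nat.mem_primesBelow] at hp ⊢
      exact ⟨hp.1.trans_le (hM.trans Nat.lt_two_pow_self.le), hp.2⟩
    · exact neg_log_one_sub_sub_nonneg
        (natCast_rpow_neg_lt_one (Nat.prime_of_mem_primesBelow hp) (by linarith))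
  rw [Finset.sum_sub_distrib (s := Nat.primesBelow (2 ^ M))] at h2
  have h3 : ∑ i ∈ Finset.range M,
      (2 : ℝ) ^ (-δ) * (dyadicPrimeSum i * ((2 : ℝ) ^ (-δ)) ^ i) =
      ∑ i ∈ Finset.range M, dyadicPrimeSum i * ((2 : ℝ) ^ (-δ)) ^ (i + 1) :=
    Finset.sum_congr rfl fun i _ => by ring
  rw [h3]
  linarith

/-- The comparison series is `∑ r ^ i / i = -log (1 - r)`. -/
theorem tsum_dyadicPrimeSum_mul_pow {r : ℝ} (h0 : 0 ≤ r) (h1 : r < 1) :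
    ∑' i, dyadicPrimeSum i * r ^ i =
      ∑' i : ℕ, (dyadicPrimeSum i - 1 / (i : ℝ)) * r ^ i - Real.log (1 - r) := by
  have h : HasSum (fun i : ℕ => 1 / (i : ℝ) * r ^ i) (-Real.log (1 - r)) := by
    rw [← hasSum_nat_add_iff' 1]
    simpa [div_eq_inv_mul] using
      Real.hasSum_pow_div_log_of_abs_lt_one (abs_lt.2 ⟨by linarith, h1⟩)
  have h2 := (summable_dyadicPrimeSum_mul_pow h0 h1).hasSum.sub h
  simp only [← sub_mul] at h2
  rw [h2.tsum_eq]
  ring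

/-- The limit `δ → 0⁺` of `dyadicPrimeSum_tsum_add_le`: the constant of Mertens' second theorem and
the correction from higher prime powers add up to at most Euler's constant. -/
theorem add_sum_neg_log_one_sub_sub_le {B : ℝ}
    (hB : Tendsto (fun n : ℕ => ∑ p ∈ n.primesBelow, 1 / (p : ℝ) - Real.log (Real.log n))
      atTop (𝓝 B)) (P : ℕ) :
    B + ∑ p ∈ P.primesBelow, (-Real.log (1 - 1 / (p : ℝ)) - 1 / (p : ℝ)) ≤
      Real.eulerMascheroniConstant := by
  have hlog2 : 0 < Real.log 2 := Real.log_pos (by norm_num)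
  set r : ℝ → ℝ := fun δ => (2 : ℝ) ^ (-δ) with hr
  have hr1 : ∀ δ, 0 < δ → r δ < 1 := fun δ hδ =>
    Real.rpow_lt_one_of_one_lt_of_neg (by norm_num) (by linarith)
  have hderiv : HasDerivAt r (-Real.log 2) 0 := by
    have := (hasDerivAt_neg (0 : ℝ)).const_rpow (a := 2) (by norm_num)
    simpa using this
  have hr_zero : r 0 = 1 := by simp [hr]
  have hr_lim : Tendsto r (𝓝[>] 0) (𝓝[<] 1) := by
    refine tendsto_nhdsWithin_iff.2 ⟨?_, ?_⟩
    · have := hderiv.continuousAt.tendsto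
      rw [hr_zero] at this
      exact this.mono_left nhdsWithin_le_nhds
    · filter_upwards [self_mem_nhdsWithin] with δ hδ using hr1 δ hδ
  have hr_lim' := tendsto_nhds_of_tendsto_nhdsWithin hr_lim
  have hAbel := (Real.tendsto_tsum_powerSeries_nhdsWithin_lt
    (tendsto_sum_dyadicPrimeSum_sub hB)).comp hr_lim
  have hquot : Tendsto (fun δ => Real.log ((1 - r δ) / δ)) (𝓝[>] 0)
      (𝓝 (Real.log (Real.log 2))) := by
    refine Tendsto.log ?_ hlog2.ne'
    have := hderiv.tendsto_slope_zero_right.neg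
    rw [neg_neg] at this
    refine this.congr fun δ => ?_
    rw [zero_add, hr_zero, smul_eq_mul]
    ring
  have hmul : Tendsto (fun δ => Real.log (1 - r δ) * (1 - r δ)) (𝓝[>] 0) (𝓝 0) := by
    have := (Real.continuous_mul_log.tendsto (1 - 1)).comp (hr_lim'.const_sub 1)
    simpa [Function.comp_def, mul_comm] using this
  have hzeta : Tendsto (fun δ => Real.log (δ * ∑' n : ℕ, 1 / (n : ℝ) ^ (1 + δ))) (𝓝[>] 0)
      (𝓝 0) := by
    have h1 : Tendsto (fun δ : ℝ => 1 + δ) (𝓝[>] 0) (𝓝[>] 1) := by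
      refine tendsto_nhdsWithin_iff.2 ⟨?_, ?_⟩
      · have : Tendsto (fun δ : ℝ => 1 + δ) (𝓝 0) (𝓝 (1 + 0)) :=
          (continuous_const.add continuous_id).tendsto 0
        rw [add_zero] at this
        exact this.mono_left nhdsWithin_le_nhds
      · filter_upwards [self_mem_nhdsWithin] with δ hδ
        simpa using hδ
    have := (tendsto_sub_mul_tsum_nat_rpow.comp h1).log one_ne_zero
    rw [Real.log_one] at this
    exact this.congr fun δ => by simp [Function.comp]
  have hfin : Tendsto (fun δ : ℝ => ∑ p ∈ P.primesBelow,
      (-Real.log (1 - (p : ℝ) ^ (-(1 + δ))) - (p : ℝ) ^ (-(1 + δ)))) (𝓝[>] 0)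
      (𝓝 (∑ p ∈ P.primesBelow, (-Real.log (1 - 1 / (p : ℝ)) - 1 / (p : ℝ)))) := by
    refine tendsto_finsetSum _ fun p hp => ?_
    have hpp := Nat.prime_of_mem_primesBelow hp
    have hp0 : (p : ℝ) ≠ 0 := by exact_mod_cast hpp.ne_zero
    have hp1 : (1 : ℝ) < p := by exact_mod_cast hpp.one_lt
    have h1 : Tendsto (fun δ : ℝ => (p : ℝ) ^ (-(1 + δ))) (𝓝[>] 0) (𝓝 (1 / (p : ℝ))) := by
      have : ContinuousAt (fun δ : ℝ => (p : ℝ) ^ (-(1 + δ))) 0 :=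
        ContinuousAt.rpow continuousAt_const (by fun_prop) (Or.inl hp0)
      have := this.tendsto
      rw [add_zero, Real.rpow_neg_one, ← one_div] at this
      exact this.mono_left nhdsWithin_le_nhds
    refine Tendsto.sub (Tendsto.neg (Tendsto.log (h1.const_sub 1) ?_)) h1
    have : 1 / (p : ℝ) < 1 := by rw [div_lt_one (by linarith)]; exact hp1
    linarith
  -- the inequality `dyadicPrimeSum_tsum_add_le` with the divergent term `log δ` cancelled
  have hlim := (((((hr_lim'.mul hAbel).sub hquot).add hmul).add hfin).sub hzeta)
  have hle := le_of_tendsto hlim (b := 0) (by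
    filter_upwards [self_mem_nhdsWithin] with δ hδ
    have hδ : 0 < δ := hδ
    have h := dyadicPrimeSum_tsum_add_le hδ P
    have h1 := hr1 δ hδ
    rw [tsum_dyadicPrimeSum_mul_pow (by positivity) h1] at h
    have hzpos : 0 < ∑' n : ℕ, 1 / (n : ℝ) ^ (1 + δ) :=
      (Real.summable_one_div_nat_rpow.2 (by linarith)).tsum_pos
        (fun n => by positivity) 1 (by simp)
    rw [Real.log_mul hδ.ne' hzpos.ne', Real.log_div (by linarith) hδ.ne']
    simp only [Function.comp, hr] at h ⊢
    linarith)
  linarith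

/-- **Mertens' third theorem**, upper bound. -/
theorem eventually_sum_neg_log_one_sub_le {η : ℝ} (hη : 0 < η) :
    ∀ᶠ n : ℕ in atTop, ∑ p ∈ n.primesBelow, -Real.log (1 - 1 / (p : ℝ)) ≤
      Real.log (Real.log n) + Real.eulerMascheroniConstant + η := by
  obtain ⟨B, hB⟩ := exists_tendsto_sum_one_div_sub_log_log
  filter_upwards [hB.eventually_le_const (lt_add_of_pos_right B hη)] with n hn
  have h := add_sum_neg_log_one_sub_sub_le hB n
  rw [Finset.sum_sub_distrib] at h
  linarith

/-! ### Products of the first primes -/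

theorem kthPrime_strictMonoOn : StrictMonoOn kthPrime (Set.Ici 1) := fun a ha b hb hab => by
  have ha : 1 ≤ a := ha
  exact Nat.nth_strictMono Nat.infinite_setOfPred_prime (by lia)

theorem image_kthPrime_Icc {m : ℕ} (hm : 1 ≤ m) :
    (Finset.Icc 1 m).image kthPrime = (kthPrime m + 1).primesBelow := by
  ext p
  rw [Finset.mem_image, Nat.mem_primesBelow]
  constructor
  · rintro ⟨k, hk, rfl⟩
    rw [Finset.mem_Icc] at hk
    exact ⟨Nat.lt_succ_of_le (kthPrime_strictMonoOn.monotoneOn hk.1 hm hk.2), kthPrime_prime k⟩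
  · rintro ⟨hlt, hp⟩
    refine ⟨Nat.count Nat.Prime p + 1, ?_, ?_⟩
    · rw [Finset.mem_Icc]
      refine ⟨by lia, ?_⟩
      have h1 : Nat.count Nat.Prime p ≤ Nat.count Nat.Prime (kthPrime m) :=
        Nat.count_monotone _ (Nat.le_of_lt_succ hlt)
      have h2 : Nat.count Nat.Prime (kthPrime m) = m - 1 :=
        Nat.count_nth_of_infinite Nat.infinite_setOfPred_prime _
      lia
    · exact Nat.nth_count hp

theorem sum_kthPrime {m : ℕ} (hm : 1 ≤ m) (f : ℕ → ℝ) :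
    ∑ k ∈ Finset.Icc 1 m, f (kthPrime k) = ∑ p ∈ (kthPrime m + 1).primesBelow, f p := by
  rw [← image_kthPrime_Icc hm, Finset.sum_image]
  exact kthPrime_strictMonoOn.injOn.mono fun k hk => (Finset.mem_Icc.1 hk).1

theorem log_firstPrimesProd (m : ℕ) :
    Real.log (firstPrimesProd m) = ∑ k ∈ Finset.Icc 1 m, Real.log (kthPrime k) := by
  rw [firstPrimesProd, Nat.cast_prod, Real.log_prod]
  exact fun k _ => by exact_mod_cast (kthPrime_prime k).ne_zero

theorem log_firstPrimesProd_eq_theta {m : ℕ} (hm : 1 ≤ m) :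
    Real.log (firstPrimesProd m) = Chebyshev.theta (kthPrime m) := by
  rw [log_firstPrimesProd, sum_kthPrime hm fun p => Real.log p,
    Chebyshev.theta_eq_sum_primesLE_log]
  rfl

theorem log_primePowProd (m : ℕ) (α : ℕ → ℕ) :
    Real.log (primePowProd m α) = ∑ k ∈ Finset.Icc 1 m, α k * Real.log (kthPrime k) := by
  rw [primePowProd, Nat.cast_prod, Real.log_prod]
  · exact Finset.sum_congr rfl fun k _ => by rw [Nat.cast_pow, Real.log_pow]
  · exact fun k _ => by exact_mod_cast pow_ne_zero _ (kthPrime_prime k).ne_zero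

theorem firstPrimesProd_pos (m : ℕ) : 0 < firstPrimesProd m :=
  Finset.prod_pos fun k _ => (kthPrime_prime k).pos

theorem primePowProd_pos (m : ℕ) (α : ℕ → ℕ) : 0 < primePowProd m α :=
  Finset.prod_pos fun k _ => pow_pos (kthPrime_prime k).pos _

theorem firstPrimesProd_le_primePowProd {m : ℕ} {α : ℕ → ℕ} (hα : IsNonincreasingExponents m α) :
    firstPrimesProd m ≤ primePowProd m α :=
  Finset.prod_le_prod' fun k hk =>
    Nat.le_self_pow (Nat.one_le_iff_ne_zero.1 (hα.1 k (Finset.mem_Icc.1 hk))) _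

theorem firstPrimesProd_mono {m M : ℕ} (h : m ≤ M) : firstPrimesProd m ≤ firstPrimesProd M :=
  Finset.prod_le_prod_of_subset_of_one_le' (Finset.Icc_subset_Icc_right h)
    fun k _ _ => (kthPrime_prime k).one_le

/-- A consequence of Bertrand's postulate. -/
theorem kthPrime_le_two_pow {k : ℕ} (hk : 1 ≤ k) : kthPrime k ≤ 2 ^ k := by
  induction k, hk using Nat.le_induction with
  | base => simp [kthPrime, Nat.nth_prime_zero_eq_two]
  | succ k hk ih =>
    obtain ⟨p, hp, h1, h2⟩ := Nat.exists_prime_lt_and_le_two_mul _ (kthPrime_prime k).ne_zero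
    have h3 : kthPrime (k + 1) ≤ p := by
      have h4 : Nat.count Nat.Prime (kthPrime k) < Nat.count Nat.Prime p :=
        Nat.count_strict_mono (kthPrime_prime k) h1
      have h5 : Nat.count Nat.Prime (kthPrime k) = k - 1 :=
        Nat.count_nth_of_infinite Nat.infinite_setOfPred_prime _
      rw [← Nat.nth_count hp]
      exact Nat.nth_monotone Nat.infinite_setOfPred_prime (by lia)
    rw [pow_succ]
    lia

theorem tendsto_kthPrime : Tendsto kthPrime atTop atTop := by
  rw [← tendsto_add_atTop_iff_nat 1]
  exact (Nat.nth_strictMono Nat.infinite_setOfPred_prime).tendsto_atTop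

theorem log_firstPrimesProd_le (m : ℕ) :
    Real.log (firstPrimesProd m) ≤ m ^ 2 * Real.log 2 := by
  rw [log_firstPrimesProd]
  have h : ∀ k ∈ Finset.Icc 1 m, Real.log (kthPrime k) ≤ m * Real.log 2 := fun k hk => by
    rw [Finset.mem_Icc] at hk
    rw [← Real.log_pow]
    refine Real.log_le_log (by exact_mod_cast (kthPrime_prime k).pos) ?_
    exact_mod_cast (kthPrime_le_two_pow hk.1).trans (Nat.pow_le_pow_right (by norm_num) hk.2)
  refine (Finset.sum_le_card_nsmul _ _ _ h).trans (le_of_eq ?_)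
  rw [Nat.card_Icc, nsmul_eq_mul, Nat.add_sub_cancel]
  ring

/-- A bounded number of primes would bound the numbers `(∏ p_k) ^ (1 + ε)`. -/
theorem tendsto_length {m : ℕ → ℕ} {α : ℕ → ℕ → ℕ}
    (hm : ∀ j, 1 ≤ m j)
    (hlim : Tendsto (fun j => primePowProd (m j) (α j)) atTop atTop)
    (hε : Tendsto (fun j => epsilonExp (m j) (primePowProd (m j) (α j))) atTop (𝓝 0)) :
    Tendsto m atTop atTop := by
  refine tendsto_atTop.2 fun M => ?_
  filter_upwards [hlim.eventually_gt_atTop (firstPrimesProd M ^ 2),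
    hε.eventually_le_const one_pos] with j h1 h2
  by_contra! h
  have hP : (1 : ℝ) ≤ firstPrimesProd (m j) := by exact_mod_cast firstPrimesProd_pos _
  have h3 := rpow_one_add_epsilonExp (hm j) (primePowProd_pos (m j) (α j))
  have h4 := Real.rpow_le_rpow_of_exponent_le hP
    (by push_cast; linarith : 1 + epsilonExp (m j) (primePowProd (m j) (α j)) ≤ (2 : ℕ))
  rw [h3, Real.rpow_natCast] at h4
  have h5 : primePowProd (m j) (α j) ≤ firstPrimesProd (m j) ^ 2 := by exact_mod_cast h4
  have h6 := Nat.pow_le_pow_left (firstPrimesProd_mono h.le) 2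
  lia

/-- If `α k > k` for all `k ≤ L`, the excess `ε log ∏ p_k = ∑ (α k - 1) log p_k` is at least
`∑_{k ≤ L} k log 2`, while `log ∏ p_k ≤ m² log 2`. -/
theorem sq_le_of_forall_lt {m L : ℕ} {α : ℕ → ℕ} (hm : 1 ≤ m) (hL : L ≤ m)
    (hα : IsNonincreasingExponents m α) (h : ∀ k ∈ Set.Icc 1 L, k < α k) :
    (L : ℝ) ^ 2 ≤ 2 * epsilonExp m (primePowProd m α) * m ^ 2 := by
  have hlog2 : 0 < Real.log 2 := Real.log_pos (by norm_num)
  have hP : (1 : ℝ) < firstPrimesProd m := by exact_mod_cast one_lt_firstPrimesProd hm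
  have hlogP := Real.log_pos hP
  have hε : epsilonExp m (primePowProd m α) * Real.log (firstPrimesProd m) =
      Real.log (primePowProd m α) - Real.log (firstPrimesProd m) := by
    rw [epsilonExp]; field_simp
  have hε0 : 0 ≤ epsilonExp m (primePowProd m α) := by
    refine nonneg_of_mul_nonneg_left (b := Real.log (firstPrimesProd m)) ?_ hlogP
    rw [hε, sub_nonneg]
    exact Real.log_le_log (by linarith) (by exact_mod_cast firstPrimesProd_le_primePowProd hα)
  have h2 : ∀ k, Real.log 2 ≤ Real.log (kthPrime k) := fun k =>
    Real.log_le_log (by norm_num) (by exact_mod_cast (kthPrime_prime k).two_le)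
  have hexcess : ∑ k ∈ Finset.Icc 1 L, (k : ℝ) * Real.log 2 ≤
      Real.log (primePowProd m α) - Real.log (firstPrimesProd m) := by
    rw [log_primePowProd, log_firstPrimesProd, ← Finset.sum_sub_distrib]
    calc ∑ k ∈ Finset.Icc 1 L, (k : ℝ) * Real.log 2
        ≤ ∑ k ∈ Finset.Icc 1 L, (α k * Real.log (kthPrime k) - Real.log (kthPrime k)) := by
          refine Finset.sum_le_sum fun k hk => ?_
          have h3 : (k : ℝ) + 1 ≤ α k := by exact_mod_cast h k (Finset.mem_Icc.1 hk)
          rw [← sub_one_mul]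
          exact mul_le_mul (by linarith) (h2 k) hlog2.le
            (by have : (0 : ℝ) ≤ k := Nat.cast_nonneg k; linarith)
      _ ≤ _ := by
          refine Finset.sum_le_sum_of_subset_of_nonneg (Finset.Icc_subset_Icc_right hL)
            fun k hk _ => ?_
          have h3 : (1 : ℝ) ≤ α k := by exact_mod_cast hα.1 k (Finset.mem_Icc.1 hk)
          rw [← sub_one_mul]
          exact mul_nonneg (by linarith) (hlog2.le.trans (h2 k))
  -- the sum is `L * (L + 1) / 2`
  have hgauss : ∀ L : ℕ, (L : ℝ) ^ 2 / 2 ≤ ∑ k ∈ Finset.Icc 1 L, (k : ℝ) := fun L => by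
    induction L with
    | zero => simp
    | succ L ih =>
      rw [Finset.sum_Icc_succ_top (by lia)]
      push_cast
      linarith
  rw [← Finset.sum_mul, ← hε] at hexcess
  have h4 := mul_le_mul_of_nonneg_right (hgauss L) hlog2.le
  have h5 := mul_le_mul_of_nonneg_left (log_firstPrimesProd_le m) hε0
  refine le_of_mul_le_mul_right ?_ hlog2
  linarith

/-! ### Chebyshev's lower bound and the sum of divisors -/

theorem eventually_half_le_theta :
    ∀ᶠ n : ℕ in atTop, (n : ℝ) / 2 ≤ Chebyshev.theta n := by
  -- `log n ≤ √n / 40` makes the error terms small compared with `(log 2 - 1 / 2) * n`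
  have h := (isLittleO_log_rpow_atTop (by norm_num : (0 : ℝ) < 1 / 2)).bound
    (by norm_num : (0 : ℝ) < 1 / 40)
  filter_upwards [tendsto_natCast_atTop_atTop.eventually h, eventually_ge_atTop 100] with n hn h100
  have hn0 : (100 : ℝ) ≤ n := by exact_mod_cast h100
  rw [← Real.sqrt_eq_rpow, Real.norm_of_nonneg (Real.log_nonneg (by linarith)),
    Real.norm_of_nonneg (Real.sqrt_nonneg _)] at hn
  have hs := Real.mul_self_sqrt (by linarith : (0 : ℝ) ≤ n)
  have hs10 : 10 ≤ √(n : ℝ) := Real.le_sqrt_of_sq_le (by norm_num; linarith)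
  have h1 : Real.log (n + 1) ≤ Real.log n + Real.log 2 := by
    rw [← Real.log_mul (by linarith) (by norm_num)]
    exact Real.log_le_log (by linarith) (by linarith)
  have h2 := Chebyshev.theta_ge n
  have h3 := Real.log_two_gt_d9
  have h4 := Real.log_two_lt_d9
  have h5 : √(n : ℝ) * Real.log n ≤ n / 40 := by nlinarith
  nlinarith

theorem sigma_one_prime_pow {p : ℕ} (hp : p.Prime) (a : ℕ) :
    (ArithmeticFunction.sigma 1 (p ^ a) : ℝ) =
      (p : ℝ) ^ a * (1 - 1 / (p : ℝ))⁻¹ * (1 - 1 / (p : ℝ) ^ (a + 1)) := by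
  have h1 : (1 : ℝ) < p := by exact_mod_cast hp.one_lt
  have h2 : (p : ℝ) - 1 ≠ 0 := by linarith
  have h0 : (p : ℝ) ≠ 0 := by linarith
  rw [ArithmeticFunction.sigma_one_apply_prime_pow hp]
  push_cast
  rw [geom_sum_eq h1.ne', ← div_self h0, ← sub_div, inv_div]
  field_simp
  ring

/-- The factors `1 - p_k ^ (-α k - 1)` of `σ(n) / n` are at most `1`, and the one with `k = K` is at
most `1 - p_K ^ (-A - 1)`. -/
theorem sigma_primePowProd_le {m K A : ℕ} {α : ℕ → ℕ} (hm : 1 ≤ m) (hK : K ∈ Set.Icc 1 m)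
    (hA : α K ≤ A) :
    (ArithmeticFunction.sigma 1 (primePowProd m α) : ℝ) ≤
      primePowProd m α *
        Real.exp (∑ p ∈ (kthPrime m + 1).primesBelow, -Real.log (1 - 1 / (p : ℝ))) *
        (1 - 1 / (kthPrime K : ℝ) ^ (A + 1)) := by
  have hp1 : ∀ k, (1 : ℝ) < kthPrime k := fun k => by exact_mod_cast (kthPrime_prime k).one_lt
  have hmult : ArithmeticFunction.sigma 1 (primePowProd m α) =
      ∏ k ∈ Finset.Icc 1 m, ArithmeticFunction.sigma 1 (kthPrime k ^ α k) := by
    refine ArithmeticFunction.isMultiplicative_sigma.map_prod _ _ fun i hi j hj hij => ?_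
    refine Nat.Coprime.pow _ _ ((Nat.coprime_primes (kthPrime_prime i) (kthPrime_prime j)).2 ?_)
    exact fun h => hij (kthPrime_strictMonoOn.injOn (Finset.mem_Icc.1 hi).1
      (Finset.mem_Icc.1 hj).1 h)
  have hexp : Real.exp (∑ p ∈ (kthPrime m + 1).primesBelow, -Real.log (1 - 1 / (p : ℝ))) =
      ∏ k ∈ Finset.Icc 1 m, (1 - 1 / (kthPrime k : ℝ))⁻¹ := by
    rw [← sum_kthPrime hm fun p => -Real.log (1 - 1 / (p : ℝ)), Real.exp_sum]
    refine Finset.prod_congr rfl fun k _ => ?_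
    rw [Real.exp_neg, Real.exp_log]
    rw [sub_pos, div_lt_one (by linarith [hp1 k])]
    exact hp1 k
  have hf : ∀ k a, (0 : ℝ) ≤ 1 - 1 / (kthPrime k : ℝ) ^ a ∧
      1 - 1 / (kthPrime k : ℝ) ^ a ≤ 1 := fun k a => by
    have h1 : 1 ≤ (kthPrime k : ℝ) ^ a := one_le_pow₀ (hp1 k).le
    have h2 : 1 / (kthPrime k : ℝ) ^ a ≤ 1 := (div_le_one (by linarith)).2 h1
    have h3 : 0 ≤ 1 / (kthPrime k : ℝ) ^ a := by positivity
    constructor <;> linarith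
  have hlast : ∏ k ∈ Finset.Icc 1 m, (1 - 1 / (kthPrime k : ℝ) ^ (α k + 1)) ≤
      1 - 1 / (kthPrime K : ℝ) ^ (A + 1) := by
    rw [← Finset.mul_prod_erase _ _ (Finset.mem_Icc.2 hK)]
    refine (mul_le_of_le_one_right (hf _ _).1
      (Finset.prod_le_one (fun k _ => (hf _ _).1) fun k _ => (hf _ _).2)).trans ?_
    have : (kthPrime K : ℝ) ^ (α K + 1) ≤ (kthPrime K : ℝ) ^ (A + 1) :=
      pow_le_pow_right₀ (hp1 K).le (by lia)
    have := one_div_le_one_div_of_le (pow_pos (by linarith [hp1 K]) _) this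
    linarith
  rw [hmult, Nat.cast_prod, Finset.prod_congr rfl fun k _ =>
    sigma_one_prime_pow (kthPrime_prime k) (α k), Finset.prod_mul_distrib,
    Finset.prod_mul_distrib, ← hexp]
  have : (primePowProd m α : ℝ) = ∏ k ∈ Finset.Icc 1 m, (kthPrime k : ℝ) ^ α k := by
    rw [primePowProd]; push_cast; rfl
  rw [← this]
  exact mul_le_mul_of_nonneg_left hlast (by positivity)

/-! ### The limit theorem -/

/-- If the exponents are bounded from some index on, one factor `1 - p ^ (-A - 1)` of `σ(n) / n`
outweighs the error terms of the theorems of Mertens and Chebyshev. -/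
theorem tendsto_robinDifference {m : ℕ → ℕ} {α : ℕ → ℕ → ℕ}
    (hm : ∀ j, 1 ≤ m j) (hα : ∀ j, IsNonincreasingExponents (m j) (α j))
    (hm_lim : Tendsto m atTop atTop) {A K₀ : ℕ} (hK₀ : 1 ≤ K₀)
    (hA : ∀ j, ∀ k ∈ Set.Icc K₀ (m j), α j k ≤ A) :
    Tendsto (fun j => robinDifference (primePowProd (m j) (α j))) atTop atTop := by
  set κ : ℝ := 1 / (kthPrime K₀ : ℝ) ^ (A + 1) with hκ
  have hpK : (1 : ℝ) < kthPrime K₀ := by exact_mod_cast (kthPrime_prime K₀).one_lt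
  have hκ0 : 0 < κ := by positivity
  have hκ1 : κ < 1 := (div_lt_one (by positivity)).2 (one_lt_pow₀ hpK (by lia))
  -- `exp η * (1 - κ) = √(1 - κ) < 1`
  set η : ℝ := -Real.log (1 - κ) / 2 with hη
  have hη0 : 0 < η := by
    have := Real.log_neg (by linarith : 0 < 1 - κ) (by linarith)
    rw [hη]; linarith
  set q : ℝ := Real.exp η * (1 - κ) with hq
  have hq1 : q < 1 := by
    have : q = Real.exp (-η) := by
      rw [hq, ← Real.exp_log (by linarith : 0 < 1 - κ), ← Real.exp_add]
      congr 1
      rw [hη]; ring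
    rw [this, Real.exp_lt_one_iff]
    linarith
  set E : ℝ := Real.exp Real.eulerMascheroniConstant with hE
  have hE0 : 0 < E := Real.exp_pos _
  have hp_lim : Tendsto (fun j => kthPrime (m j)) atTop atTop := tendsto_kthPrime.comp hm_lim
  have hN_lim : Tendsto (fun j => kthPrime (m j) + 1) atTop atTop :=
    tendsto_atTop_mono (fun _ => Nat.le_succ _) hp_lim
  have hlog_lim : Tendsto (fun j => Real.log ((kthPrime (m j) + 1 : ℕ) : ℝ)) atTop atTop :=
    Real.tendsto_log_atTop.comp (tendsto_natCast_atTop_atTop.comp hN_lim)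
  have hmain : Tendsto (fun j =>
      E * ((1 - q) * Real.log ((kthPrime (m j) + 1 : ℕ) : ℝ) - Real.log 4)) atTop atTop :=
    (tendsto_atTop_add_const_right _ _ (hlog_lim.const_mul_atTop (by linarith))).const_mul_atTop
      hE0
  refine tendsto_atTop_mono' _ ?_ hmain
  filter_upwards [hm_lim.eventually_ge_atTop K₀,
    hN_lim.eventually (eventually_sum_neg_log_one_sub_le hη0),
    hp_lim.eventually eventually_half_le_theta, hmain.eventually_ge_atTop 0] with j hj h1 h2 h3
  set N : ℕ := kthPrime (m j) + 1 with hN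
  set n := primePowProd (m j) (α j) with hn
  have hp2 : (2 : ℝ) ≤ kthPrime (m j) := by exact_mod_cast (kthPrime_prime (m j)).two_le
  have hNp : (N : ℝ) = kthPrime (m j) + 1 := by rw [hN]; push_cast; rfl
  have hlogN : 0 < Real.log N := Real.log_pos (by linarith)
  have hn1 : (1 : ℝ) ≤ n := by exact_mod_cast primePowProd_pos (m j) (α j)
  have hσ := sigma_primePowProd_le (hm j) ⟨hK₀, hj⟩ (hA j K₀ ⟨le_rfl, hj⟩)
  have hexp : Real.exp (∑ p ∈ N.primesBelow, -Real.log (1 - 1 / (p : ℝ))) ≤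
      Real.log N * E * Real.exp η := by
    refine (Real.exp_le_exp.2 h1).trans (le_of_eq ?_)
    rw [Real.exp_add, Real.exp_add, Real.exp_log hlogN]
  have hσ' : (ArithmeticFunction.sigma 1 n : ℝ) ≤ n * (E * (q * Real.log N)) := by
    refine hσ.trans ?_
    rw [← hκ]
    calc n * Real.exp (∑ p ∈ N.primesBelow, -Real.log (1 - 1 / (p : ℝ))) * (1 - κ)
        ≤ n * (Real.log N * E * Real.exp η) * (1 - κ) := by
          have : 0 ≤ 1 - κ := by linarith
          gcongr
      _ = n * (E * (q * Real.log N)) := by rw [hq]; ring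
  have hloglog : Real.log N - Real.log 4 ≤ Real.log (Real.log n) := by
    rw [← Real.log_div (by linarith) (by norm_num)]
    refine Real.log_le_log (by linarith) ?_
    have h4 : Real.log (firstPrimesProd (m j)) ≤ Real.log n :=
      Real.log_le_log (by exact_mod_cast firstPrimesProd_pos _)
        (by exact_mod_cast firstPrimesProd_le_primePowProd (hα j))
    rw [log_firstPrimesProd_eq_theta (hm j)] at h4
    linarith
  have h5 : E * n * (Real.log N - Real.log 4) ≤ E * n * Real.log (Real.log n) := by gcongr
  have h6 := le_mul_of_one_le_left h3 hn1
  rw [robinDifference]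
  linarith

theorem exists_isLeast_tendsto_div {m : ℕ → ℕ} {α : ℕ → ℕ → ℕ}
    (hm : ∀ j, 1 ≤ m j) (hα : ∀ j, IsNonincreasingExponents (m j) (α j))
    (hm_lim : Tendsto m atTop atTop)
    (hε : Tendsto (fun j => epsilonExp (m j) (primePowProd (m j) (α j))) atTop (𝓝 0)) :
    ∃ K : ℕ → ℕ,
      (∀ᶠ j in atTop, IsLeast {k : ℕ | k ∈ Set.Icc 1 (m j) ∧ α j k ≤ k} (K j)) ∧
        Tendsto (fun j => (K j : ℝ) / (m j : ℝ)) atTop (𝓝 0) := by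
  set S : ℕ → Set ℕ := fun j => {k : ℕ | k ∈ Set.Icc 1 (m j) ∧ α j k ≤ k} with hS
  have key : ∀ c : ℝ, 0 < c → c ≤ 1 → ∀ᶠ j in atTop, ∃ k ∈ S j, (k : ℝ) ≤ c * m j := by
    intro c hc hc1
    filter_upwards [hε.eventually_lt_const (by positivity : 0 < c ^ 2 / 8),
      (tendsto_natCast_atTop_atTop.comp hm_lim).eventually_ge_atTop (1 / c)] with j h1 h2
    have hmj : (1 : ℝ) ≤ m j := by exact_mod_cast hm j
    have hcm : 1 ≤ c * m j := by
      have := (div_le_iff₀ hc).1 h2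
      rwa [mul_comm] at this
    by_contra! hcon
    set L := ⌊c * m j⌋₊ with hL
    have hLle : (L : ℝ) ≤ c * m j := Nat.floor_le (by linarith)
    have hLm : L ≤ m j := by
      have : (L : ℝ) ≤ m j := hLle.trans (mul_le_of_le_one_left (by linarith) hc1)
      exact_mod_cast this
    have h3 := sq_le_of_forall_lt (hm j) hLm (hα j) fun k hk => by
      by_contra! hle
      have h4 := hcon k ⟨⟨hk.1, hk.2.trans hLm⟩, hle⟩
      have h5 : (k : ℝ) ≤ L := by exact_mod_cast hk.2
      linarith
    -- `L ≥ 1`, so that rounding `c * m j` down loses at most a factor `2`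
    have h6 : c * m j / 2 ≤ L := by
      have h7 := Nat.lt_floor_add_one (c * (m j : ℝ))
      have h8 : (1 : ℝ) ≤ L := by exact_mod_cast Nat.one_le_floor_iff _ |>.2 hcm
      rw [← hL] at h7
      linarith
    have h9 := pow_le_pow_left₀ (by positivity) h6 2
    have h10 := mul_lt_mul_of_pos_right h1 (by positivity : (0 : ℝ) < (m j : ℝ) ^ 2)
    nlinarith
  refine ⟨fun j => sInf (S j), ?_, ?_⟩
  · filter_upwards [key 1 one_pos le_rfl] with j ⟨k, hk, _⟩
    exact ⟨Nat.sInf_mem ⟨k, hk⟩, fun i hi => Nat.sInf_le hi⟩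
  · rw [Metric.tendsto_nhds]
    intro c hc
    filter_upwards [key (min (c / 2) 1) (by positivity) (min_le_right _ _)] with j ⟨k, hk, hkc⟩
    have hmj : (0 : ℝ) < m j := by exact_mod_cast hm j
    have h1 : ((sInf (S j) : ℕ) : ℝ) ≤ k := by exact_mod_cast Nat.sInf_le hk
    rw [Real.dist_eq, sub_zero, abs_of_nonneg (by positivity), div_lt_iff₀ hmj]
    calc ((sInf (S j) : ℕ) : ℝ) ≤ min (c / 2) 1 * m j := h1.trans hkc
      _ ≤ c / 2 * m j := by gcongr; exact min_le_left _ _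
      _ < c * m j := by gcongr; linarith

theorem theorem4 (m : ℕ → ℕ) (α : ℕ → ℕ → ℕ) (n : ℕ → ℕ)
    (hm : ∀ j, 1 ≤ m j)
    (hα : ∀ j, IsNonincreasingExponents (m j) (α j))
    (hn : ∀ j, n j = primePowProd (m j) (α j))
    (hn_lim : Tendsto n atTop atTop)
    (hε : Tendsto (fun j => epsilonExp (m j) (n j)) atTop (𝓝 0)) :
    ((∃ A K₀ : ℕ, 1 ≤ A ∧ 1 ≤ K₀ ∧ ∀ j, ∀ k ∈ Set.Icc K₀ (m j), α j k ≤ A) →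
      Tendsto (fun j => robinDifference (n j)) atTop atTop ∧
        ∀ᶠ j in atTop, 0 < robinDifference (n j)) ∧
    (∃ K : ℕ → ℕ,
      (∀ᶠ j in atTop, IsLeast {k : ℕ | k ∈ Set.Icc 1 (m j) ∧ α j k ≤ k} (K j)) ∧
        Tendsto (fun j => (K j : ℝ) / (m j : ℝ)) atTop (𝓝 0)) := by
  obtain rfl : n = fun j => primePowProd (m j) (α j) := funext hn
  have hm_lim := tendsto_length hm hn_lim hε
  refine ⟨?_, exists_isLeast_tendsto_div hm hα hm_lim hε⟩
  rintro ⟨A, K₀, -, hK₀, hA⟩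
  have h := tendsto_robinDifference hm hα hm_lim hK₀ hA
  exact ⟨h, h.eventually_gt_atTop 0⟩
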